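/- Model. Transmitters form a homogeneous Poisson point process of density $\lambda>0$ in the plane, seen by a typical transmitter–receiver pair at distance $d>0$ (the other transmitters form a Poisson process of density $\lambda$). Each transmitter has a battery of integer capacity $B\ge 1$. With energy arrival probability $p\in(0,1]$ and ALOHA access probability $q\in[0,1]$, its stored energy is a birth–death chain on $\{0,\dots,B\}$ that moves up with probability $p$ from $0$ and $p(1-q)$ from $1,\dots,B-1$, moves down with probability $q(1-p)$ from $1,\dots,B$, and otherwise stays put. Let $r_B=r_B(q)$ be the stationary probability that the energy is nonzero, and $f_B(q)=q\,r_B(q)$. In a slot each transmitter, in the stationary regime, is active if its energy is nonzero and an independent coin with success probability $q$ comes up heads. The fading coefficients $h$ are Rayleigh distributed with a common scale, and all locations, fading coefficients and the energies and coins of different transmitters are independent. For the typical pair let $$\mathsf{SIR}=\frac{d^{-\alpha}|h_0|^2}{\sum_{s\ \mathrm{active}} d_s^{-\alpha}|h_s|^2},\qquad \alpha>2,$$ where the sum is over the other transmitters and $d_s$ is their distance to the typical receiver. For a threshold $\theta>0$ the transmission capacity is $$C(q)=\lambda\, q\, r_B(q)\; P(\mathsf{SIR}>\theta)\,\log_2(1+\theta).$$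 Put $\kappa(\alpha)=\frac{2\pi^2}{\alpha\sin(2\pi/\alpha)}$ and $\lambda_{\max}=\frac{1}{d^2\theta^{2/\alpha}\kappa(\alpha)}$. Theorem. $C$ has exactly one maximizer $q^\star$ over $q\in[0,1]$, and $q^\star=\min\{\hat q,1\}$, where $\hat q$ is the solution of $f_B(x)=\lambda_{\max}/\lambda$. More precisely: if $\lambda_{\max}/\lambda\le p$, this equation has exactly one solution $\hat q$ in $[0,1]$ and $q^\star=\hat q$; if $\lambda_{\max}/\lambda>p$, it has no solution in $[0,1]$ and $q^\star=1$. (Here $\hat q$ is the least nonnegative solution, with $\hat q=+\infty$ if there is none, for any extension of $f_B$ to arguments outside $[0,1]$.) -/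

import Mathlib

open MeasureTheory ProbabilityTheory Set
open scoped ENNReal Matrix

namespace HarvestAloha

noncomputable section

/-! ### The energy queue with battery capacity `B` -/

/-- One-step probability of moving from energy level `i` to `i + 1` (when `i < B`):
with energy arrival probability `p` and access probability `q`. -/
def birthProb (p q : ℝ) (i : ℕ) : ℝ := if i = 0 then p else p * (1 - q)

/-- One-step probability of moving from energy level `i` to `i - 1`. -/
def deathProb (p q : ℝ) (i : ℕ) : ℝ := if i = 0 then 0 else q * (1 - p)

/-- Transition matrix of the finite birth–death energy queue on `{0, …, B}`; at the full
level `B` no upward move is possible (energy that does not fit is lost). -/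
def queueMatrix (p q : ℝ) (B : ℕ) : Matrix (Fin (B + 1)) (Fin (B + 1)) ℝ :=
  fun i j =>
    if (j : ℕ) = i + 1 then birthProb p q i
    else if (j : ℕ) + 1 = i then deathProb p q i
    else if i = j then 1 - (if (i : ℕ) < B then birthProb p q i else 0) - deathProb p q i
    else 0

/-- `ν` is a stationary probability distribution of the energy queue. -/
def IsStationary (p q : ℝ) {B : ℕ} (ν : Fin (B + 1) → ℝ) : Prop :=
  ν ∈ stdSimplex ℝ (Fin (B + 1)) ∧ ν ᵥ* queueMatrix p q B = ν

/-- Probability, under `ν`, that the queue is nonempty. -/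
def nonemptyProb {B : ℕ} (ν : Fin (B + 1) → ℝ) : ℝ := ∑ i with i ≠ 0, ν i

/-! ### Poisson point process and Rayleigh fading -/

/-- The plane in which the nodes are placed, with its Euclidean distance. -/
abbrev Plane : Type := EuclideanSpace ℝ (Fin 2)

/-- Number of the random points `X 0, X 1, …` that lie in `A`. -/
def pointCount {Ω : Type*} (X : ℕ → Ω → Plane) (A : Set Plane) (ω : Ω) : ℝ≥0∞ :=
  ∑' n, A.indicator (fun _ => (1 : ℝ≥0∞)) (X n ω)

/-- The random points `X 0, X 1, …` form a homogeneous Poisson point process of density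
`lam`: counts in sets of finite area are Poisson distributed, and counts in disjoint
sets are independent. -/
structure IsPoissonProcess {Ω : Type*} [MeasurableSpace Ω] (μ : Measure Ω)
    (lam : ℝ) (X : ℕ → Ω → Plane) : Prop where
  measurable : ∀ n, Measurable (X n)
  count_law : ∀ A : Set Plane, MeasurableSet A → volume A ≠ ∞ → ∀ k : ℕ,
    μ.real {ω | pointCount X A ω = k} =
      Real.exp (-(lam * volume.real A)) * (lam * volume.real A) ^ k / k.factorial
  count_indep : ∀ (m : ℕ) (A : Fin m → Set Plane), (∀ i, MeasurableSet (A i)) →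
    (∀ i, volume (A i) ≠ ∞) → (∀ i j, i ≠ j → Disjoint (A i) (A j)) →
    iIndepFun (fun i => pointCount X (A i)) μ

/-- The Rayleigh distribution with scale `σ`. -/
def rayleighMeasure (σ : ℝ) : Measure ℝ :=
  volume.withDensity fun x =>
    ENNReal.ofReal (if 0 ≤ x then x / σ ^ 2 * Real.exp (-x ^ 2 / (2 * σ ^ 2)) else 0)

/-! ### The network in one time slot, as seen by a typical transmitter–receiver pair -/

/-- The random quantities of one slot: `loc n` is the location of the `n`-th transmitter other
than the typical one, `gain n` the fading coefficient from it to the typical receiver,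
`energy n` its stored energy and `attempt n` its ALOHA coin; `ownGain` is the fading
coefficient of the typical pair. -/
structure Network (B : ℕ) (Ω : Type*) where
  loc : ℕ → Ω → Plane
  ownGain : Ω → ℝ
  gain : ℕ → Ω → ℝ
  energy : ℕ → Ω → Fin (B + 1)
  attempt : ℕ → Ω → Bool

namespace Network

variable {B : ℕ} {Ω : Type*}

/-- A transmitter is active when it has energy and its coin tells it to transmit. -/
def active (N : Network B Ω) (n : ℕ) (ω : Ω) : Prop :=
  1 ≤ (N.energy n ω : ℕ) ∧ N.attempt n ω = true

/-- The marks (fading, energy, coin) of the `n`-th transmitter. -/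
def mark (N : Network B Ω) (n : ℕ) (ω : Ω) : ℝ × Fin (B + 1) × Bool :=
  (N.gain n ω, N.energy n ω, N.attempt n ω)

open Classical in
/-- Interference power at the receiver location `rx`, with path-loss exponent `α`. -/
def interference (N : Network B Ω) (α : ℝ) (rx : Plane) (ω : Ω) : ℝ≥0∞ :=
  ∑' n, (if N.active n ω then 1 else 0) *
    (ENNReal.ofReal (dist rx (N.loc n ω))) ^ (-α) * ENNReal.ofReal (N.gain n ω ^ 2)

/-- Signal-to-interference ratio of the typical pair with transmitter at `tx` and receiver
at `rx`. -/
def sir (N : Network B Ω) (α : ℝ) (tx rx : Plane) (ω : Ω) : ℝ≥0∞ :=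
  (ENNReal.ofReal (dist rx tx)) ^ (-α) * ENNReal.ofReal (N.ownGain ω ^ 2) /
    N.interference α rx ω

/-- Probability that the signal-to-interference ratio exceeds the threshold `θ`. -/
def successProb [MeasurableSpace Ω] (N : Network B Ω) (μ : Measure Ω) (α θ : ℝ)
    (tx rx : Plane) : ℝ :=
  μ.real {ω | ENNReal.ofReal θ < N.sir α tx rx ω}

/-- The probabilistic model: the transmitters form a Poisson process of density `lam`, fading
coefficients are Rayleigh, energy levels have law `ν`, coins are Bernoulli with
parameter `q`, and locations, own fading and all marks are independent. -/
structure IsModel [MeasurableSpace Ω] (N : Network B Ω) (μ : Measure Ω)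
    (lam σ q : ℝ) (ν : Fin (B + 1) → ℝ) : Prop where
  isProb : IsProbabilityMeasure μ
  loc_poisson : IsPoissonProcess μ lam N.loc
  ownGain_meas : Measurable N.ownGain
  gain_meas : ∀ n, Measurable (N.gain n)
  energy_meas : ∀ n, Measurable (N.energy n)
  attempt_meas : ∀ n, Measurable (N.attempt n)
  ownGain_law : μ.map N.ownGain = rayleighMeasure σ
  gain_law : ∀ n, μ.map (N.gain n) = rayleighMeasure σ
  energy_law : ∀ n i, μ.real {ω | N.energy n ω = i} = ν i
  attempt_law : ∀ n, μ.real {ω | N.attempt n ω = true} = q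
  energy_attempt_indep : ∀ n, IndepFun (N.energy n) (N.attempt n) μ
  gain_indep : ∀ n, IndepFun (N.gain n) (fun ω => (N.energy n ω, N.attempt n ω)) μ
  mark_indep : iIndepFun N.mark μ
  ownGain_indep : IndepFun N.ownGain (fun ω n => N.mark n ω) μ
  loc_indep : IndepFun (fun ω n => N.loc n ω)
    (fun ω => (N.ownGain ω, fun n => N.mark n ω)) μ

/-- Transmission capacity `C = λ_a · P_suc · R`, with density `λ_a = λ q r` of active
transmitters and rate `R = log₂ (1 + θ)`. -/
def capacity [MeasurableSpace Ω] (N : Network B Ω) (μ : Measure Ω)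
    (lam q : ℝ) (ν : Fin (B + 1) → ℝ) (α θ : ℝ) (tx rx : Plane) : ℝ :=
  lam * q * nonemptyProb ν * N.successProb μ α θ tx rx * Real.logb 2 (1 + θ)

end Network

/-- `κ(α) = 2 π² / (α sin (2 π / α))`. -/
def kappa (α : ℝ) : ℝ := 2 * Real.pi ^ 2 / (α * Real.sin (2 * Real.pi / α))

/-- `λ_max = 1 / (d² θ^(2/α) κ(α))`. -/
def lamMax (d θ α : ℝ) : ℝ := 1 / (d ^ 2 * θ ^ (2 / α) * kappa α)

/-- The least nonnegative solution of `f x = c`, as an extended real; `⊤` if there is none. -/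
def solution (f : ℝ → ℝ) (c : ℝ) : EReal :=
  sInf ((fun x : ℝ => (x : EReal)) '' {x | 0 ≤ x ∧ f x = c})

end

end HarvestAloha

open HarvestAloha

/-! The capacity depends on `q` only through the throughput `f q`. Put `c = lamMax / lam` and `u = f
q / c`; then `C` is a positive constant times `u * exp (-u)`, which increases strictly on `[0, 1]`
and has its only maximum at `u = 1`. It remains to see which values `f` takes.

The exponential comes from stochastic geometry. The own fading power is exponentially distributed,
so the success probability is a Laplace transform of the interference. Averaging over the
independent marks turns it into a product over the Poisson points, evaluated by the Laplace
functional (`IsPoissonProcess.laplace`). Activity thins the process by the factor `f q`, and the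
remaining planar integral yields `kappa α` through the reflection formula for Gamma
(`lintegral_pathLoss`). The result is `Network.IsModel.successProb_eq`.

For the queue, detailed balance gives `f` as a function of a ratio of geometric sums. Hence `f` is
strictly increasing from `0` to `f 1 = p` and continuous on `(0, 1]`. If `c ≤ p` the value `u = 1`
is attained exactly once; otherwise `u < 1` throughout and `q = 1` is best.

Interference may be infinite, so Laplace transforms are computed in `ℝ≥0∞` with `expNeg`, where
`expNeg ∞ = 0`. -/

namespace HarvestAloha
open Filter Topology

/-- `exp (-x)` for an extended nonnegative real `x`. -/
noncomputable def expNeg (x : ℝ≥0∞) : ℝ≥0∞ := EReal.exp (-(x : EReal))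

@[simp] theorem expNeg_zero : expNeg 0 = 1 := by simp [expNeg]

@[simp] theorem expNeg_top : expNeg ∞ = 0 := by simp [expNeg]

theorem expNeg_ofReal {x : ℝ} (hx : 0 ≤ x) :
    expNeg (ENNReal.ofReal x) = ENNReal.ofReal (Real.exp (-x)) := by
  rw [expNeg, EReal.coe_ennreal_ofReal, max_eq_left hx, ← EReal.coe_neg, EReal.exp_coe]

theorem expNeg_add (x y : ℝ≥0∞) : expNeg (x + y) = expNeg x * expNeg y := by
  rw [expNeg, EReal.coe_ennreal_add, EReal.neg_add, sub_eq_add_neg, EReal.exp_add, expNeg, expNeg]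
  · exact Or.inl (EReal.coe_ennreal_ne_bot _)
  · exact Or.inr (EReal.coe_ennreal_ne_bot _)

theorem expNeg_sum {ι : Type*} (s : Finset ι) (f : ι → ℝ≥0∞) :
    expNeg (∑ i ∈ s, f i) = ∏ i ∈ s, expNeg (f i) := by
  classical
  induction s using Finset.induction_on with
  | empty => simp
  | insert a s ha ih => rw [Finset.sum_insert ha, Finset.prod_insert ha, expNeg_add, ih]

theorem expNeg_natCast_mul (n : ℕ) (x : ℝ≥0∞) : expNeg (n * x) = expNeg x ^ n := by
  have := expNeg_sum (Finset.range n) fun _ => x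
  simpa using this

theorem expNeg_antitone : Antitone expNeg := fun x y h =>
  EReal.exp_monotone (EReal.neg_le_neg_iff.2 (by exact_mod_cast h))

theorem expNeg_le_one (x : ℝ≥0∞) : expNeg x ≤ 1 := by
  simpa using expNeg_antitone ((zero_le : 0 ≤ x))

theorem continuous_expNeg : Continuous expNeg :=
  ENNReal.continuous_exp.comp (continuous_neg.comp continuous_coe_ennreal_ereal)

theorem measurable_expNeg : Measurable expNeg := continuous_expNeg.measurable

/-- Lets a product of factors in `[0, 1]`, zero included, be written as `expNeg` of a sum over the
points, the form to which a Laplace functional applies. -/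
theorem expNeg_toENNReal_neg_log {y : ℝ≥0∞} (hy : y ≤ 1) : expNeg (-ENNReal.log y).toENNReal = y := by
  rw [expNeg, EReal.coe_toENNReal, neg_neg, ENNReal.exp_log]
  simpa using hy

/-- Independence factorizes only finite products; this is the passage to infinitely many
transmitters. -/
theorem tendsto_expNeg_sum (f : ℕ → ℝ≥0∞) :
    Tendsto (fun n => ∏ i ∈ Finset.range n, expNeg (f i)) atTop (𝓝 (expNeg (∑' i, f i))) := by
  simp_rw [← expNeg_sum]
  exact (continuous_expNeg.tendsto _).comp (ENNReal.tendsto_nat_tsum f)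

/-! ### Laplace functional of a Poisson process -/

section Poisson

variable {Ω : Type*} [MeasurableSpace Ω] {μ : Measure Ω} {lam : ℝ} {X : ℕ → Ω → Plane}

theorem measurable_pointCount (hX : ∀ n, Measurable (X n)) {A : Set Plane} (hA : MeasurableSet A) :
    Measurable (pointCount X A) :=
  Measurable.tsum fun n => (measurable_const.indicator hA).comp (hX n)

/-- Laplace transform of a variable with Poisson probabilities. -/
theorem lintegral_expNeg_poisson [IsProbabilityMeasure μ] {Z : Ω → ℝ≥0∞} (hZ : Measurable Z)
    {m : ℝ} (hm : 0 ≤ m)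
    (h : ∀ k : ℕ, μ.real {ω | Z ω = k} = Real.exp (-m) * m ^ k / k.factorial)
    {c : ℝ≥0∞} (hc : c ≠ ∞) :
    ∫⁻ ω, expNeg (c * Z ω) ∂μ = expNeg (ENNReal.ofReal m * (1 - expNeg c)) := by
  set z := Real.exp (-c.toReal) with hz
  have hcz : expNeg c = ENNReal.ofReal z := by
    rw [hz, ← expNeg_ofReal ENNReal.toReal_nonneg, ENNReal.ofReal_toReal hc]
  have hz0 : 0 ≤ z := (Real.exp_pos _).le
  have hz1 : z ≤ 1 := Real.exp_le_one_iff.2 (by simp)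
  have hmeas : ∀ k : ℕ, MeasurableSet {ω | Z ω = k} := fun k => hZ (measurableSet_singleton _)
  have hdisj : Pairwise (Function.onFun Disjoint fun k : ℕ => {ω | Z ω = k}) := by
    intro i j hij
    refine Set.disjoint_left.2 fun ω h1 h2 => hij ?_
    exact_mod_cast (h1 : Z ω = i).symm.trans h2
  have hμ : ∀ k : ℕ, μ {ω | Z ω = k} = ENNReal.ofReal (Real.exp (-m) * m ^ k / k.factorial) :=
    fun k => by rw [← h k, ofReal_measureReal]
  have hnn : ∀ x : ℝ, 0 ≤ x → ∀ k : ℕ, 0 ≤ Real.exp (-m) * x ^ k / k.factorial := fun x hx k => by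
    positivity
  have hsum : ∀ x : ℝ, HasSum (fun k : ℕ => Real.exp (-m) * x ^ k / k.factorial)
      (Real.exp (-m) * Real.exp x) := fun x => by
    have := (NormedSpace.expSeries_div_hasSum_exp x).mul_left (Real.exp (-m))
    rw [← Real.exp_eq_exp_ℝ] at this
    simpa only [mul_div_assoc] using this
  -- The Poisson weights already sum to one, so `Z` is almost surely a finite natural number.
  have huniv : μ (⋃ k : ℕ, {ω | Z ω = k}) = 1 := by
    rw [measure_iUnion hdisj hmeas]
    simp_rw [hμ]
    rw [← ENNReal.ofReal_tsum_of_nonneg (hnn m hm) (hsum m).summable, (hsum m).tsum_eq,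
      ← Real.exp_add]
    simp
  have hae : ∀ᵐ ω ∂μ, ω ∈ ⋃ k : ℕ, {ω | Z ω = k} :=
    (prob_compl_eq_zero_iff (MeasurableSet.iUnion hmeas)).2 huniv
  have hset : ∫⁻ ω, expNeg (c * Z ω) ∂μ =
      ∫⁻ ω in ⋃ k : ℕ, {ω | Z ω = k}, expNeg (c * Z ω) ∂μ := by
    rw [Measure.restrict_eq_self_of_ae_mem hae]
  rw [hset, lintegral_iUnion hmeas hdisj]
  have : ∀ k : ℕ, ∫⁻ ω in {ω | Z ω = k}, expNeg (c * Z ω) ∂μ =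
      ENNReal.ofReal (Real.exp (-m) * (m * z) ^ k / k.factorial) := by
    intro k
    rw [setLIntegral_congr_fun (g := fun _ => ENNReal.ofReal (z ^ k)) (hmeas k)]
    · rw [setLIntegral_const, hμ, ← ENNReal.ofReal_mul (pow_nonneg hz0 k), mul_pow]
      congr 1
      ring
    · intro ω hω
      simp only [mem_ofPred_eq] at hω
      simp only [hω]
      rw [mul_comm, expNeg_natCast_mul, hcz, ENNReal.ofReal_pow hz0]
  simp_rw [this]
  rw [← ENNReal.ofReal_tsum_of_nonneg (hnn _ (mul_nonneg hm hz0)) (hsum _).summable,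
    (hsum _).tsum_eq, ← Real.exp_add, hcz, ← ENNReal.ofReal_one, ← ENNReal.ofReal_sub _ hz0,
    ← ENNReal.ofReal_mul hm, expNeg_ofReal (mul_nonneg hm (by linarith))]
  congr 2
  ring

/-- The Laplace functional for a simple function supported on a set of finite area. -/
theorem IsPoissonProcess.laplace_simpleFunc [IsProbabilityMeasure μ] (h : IsPoissonProcess μ lam X)
    (hlam : 0 ≤ lam) (g : SimpleFunc Plane ℝ≥0∞) (hg : ∀ x, g x ≠ ∞)
    (hfin : ∀ y ∈ g.range, y ≠ 0 → volume (g ⁻¹' {y}) ≠ ∞) :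
    ∫⁻ ω, expNeg (∑' n, g (X n ω)) ∂μ =
      expNeg (ENNReal.ofReal lam * ∫⁻ x, (1 - expNeg (g x))) := by
  classical
  set s := g.range.filter (· ≠ 0) with hs
  -- Used twice: with `F = id` for the sum over points, and with `F y = 1 - expNeg y` for the
  -- integral.
  have hpt : ∀ F : ℝ≥0∞ → ℝ≥0∞, F 0 = 0 → ∀ x,
      F (g x) = ∑ y ∈ s, F y * (g ⁻¹' {y}).indicator (fun _ => 1) x := by
    intro F hF x
    by_cases hx : g x = 0
    · rw [hx, hF, Finset.sum_eq_zero]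
      intro y hy
      have : y ≠ 0 := (Finset.mem_filter.1 hy).2
      rw [indicator_of_notMem, mul_zero]
      simp [hx, this.symm]
    · rw [Finset.sum_eq_single (g x)]
      · simp
      · intro y _ hy
        rw [indicator_of_notMem, mul_zero]
        simpa using hy.symm
      · intro hn
        exact absurd (Finset.mem_filter.2 ⟨g.mem_range_self x, hx⟩) hn
  have hsfin : ∀ y ∈ s, y ≠ ∞ ∧ volume (g ⁻¹' {y}) ≠ ∞ := by
    intro y hy
    obtain ⟨h1, h2⟩ := Finset.mem_filter.1 hy
    refine ⟨?_, hfin y h1 h2⟩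
    obtain ⟨x, rfl⟩ := SimpleFunc.mem_range.1 h1
    exact hg x
  have hmeas : ∀ y, MeasurableSet (g ⁻¹' {y}) := fun y => g.measurableSet_preimage _
  have hcount : ∀ ω, ∑' n, g (X n ω) = ∑ y ∈ s, y * pointCount X (g ⁻¹' {y}) ω := by
    intro ω
    have hid : ∀ x, g x = ∑ y ∈ s, y * (g ⁻¹' {y}).indicator (fun _ => 1) x := hpt id rfl
    simp_rw [hid]
    rw [Summable.tsum_finsetSum fun _ _ => ENNReal.summable]
    simp_rw [ENNReal.tsum_mul_left]
    rfl
  have hindep : iIndepFun (fun (y : s) => pointCount X (g ⁻¹' {(y : ℝ≥0∞)})) μ := by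
    have h1 := h.count_indep _ (fun i => g ⁻¹' {((s.equivFin.symm i : s) : ℝ≥0∞)})
      (fun i => hmeas _) (fun i => (hsfin _ (s.equivFin.symm i).2).2) fun i j hij => by
        refine Disjoint.preimage _ (Set.disjoint_singleton.2 fun he => hij ?_)
        exact s.equivFin.symm.injective (Subtype.ext he)
    have h2 := h1.precomp (g := s.equivFin) s.equivFin.injective
    simpa using h2
  have hc : ∀ y, Measurable (pointCount X (g ⁻¹' {y})) := fun y =>
    measurable_pointCount h.measurable (hmeas y)
  have hmc : ∀ y : s, Measurable fun t : ℝ≥0∞ => expNeg (y * t) := fun y =>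
    measurable_expNeg.comp (measurable_id.const_mul _)
  have hexp : ∀ y ∈ s, ∫⁻ ω, expNeg (y * pointCount X (g ⁻¹' {y}) ω) ∂μ =
      expNeg (ENNReal.ofReal lam * volume (g ⁻¹' {y}) * (1 - expNeg y)) := by
    intro y hy
    rw [lintegral_expNeg_poisson (hc y) (mul_nonneg hlam measureReal_nonneg)
      (h.count_law _ (hmeas y) (hsfin y hy).2) (hsfin y hy).1, ENNReal.ofReal_mul hlam,
      ofReal_measureReal (hsfin y hy).2]
  calc ∫⁻ ω, expNeg (∑' n, g (X n ω)) ∂μ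
      = ∫⁻ ω, ∏ y : s, expNeg (y * pointCount X (g ⁻¹' {(y : ℝ≥0∞)}) ω) ∂μ := by
        refine lintegral_congr fun ω => ?_
        rw [hcount, expNeg_sum, ← Finset.prod_coe_sort]
    _ = ∏ y : s, ∫⁻ ω, expNeg (y * pointCount X (g ⁻¹' {(y : ℝ≥0∞)}) ω) ∂μ :=
        lintegral_prod_eq_prod_lintegral_of_indepFun Finset.univ
          (fun (y : s) ω => expNeg (y * pointCount X (g ⁻¹' {(y : ℝ≥0∞)}) ω))
          (hindep.comp (fun (y : s) t => expNeg (y * t)) hmc) fun y => (hmc y).comp (hc y)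
    _ = ∏ y ∈ s, expNeg (ENNReal.ofReal lam * volume (g ⁻¹' {y}) * (1 - expNeg y)) := by
        rw [← Finset.prod_coe_sort s]
        exact Finset.prod_congr rfl fun y _ => hexp y y.2
    _ = expNeg (ENNReal.ofReal lam * ∫⁻ x, (1 - expNeg (g x))) := by
        rw [← expNeg_sum]
        simp_rw [hpt (fun y => 1 - expNeg y) (by simp)]
        rw [lintegral_finsetSum _ fun y _ => (measurable_const.indicator (hmeas y)).const_mul _,
          Finset.mul_sum]
        congr 1
        refine Finset.sum_congr rfl fun y _ => ?_
        rw [lintegral_const_mul _ (measurable_const.indicator (hmeas y)),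
          lintegral_indicator_const (hmeas y), one_mul]
        ring

/-- The Laplace functional of a homogeneous Poisson process. -/
theorem IsPoissonProcess.laplace [IsProbabilityMeasure μ] (h : IsPoissonProcess μ lam X)
    (hlam : 0 ≤ lam) {g : Plane → ℝ≥0∞} (hg : Measurable g) :
    ∫⁻ ω, expNeg (∑' n, g (X n ω)) ∂μ =
      expNeg (ENNReal.ofReal lam * ∫⁻ x, (1 - expNeg (g x))) := by
  -- Cutting off to balls gives every nonzero level set finite area, as the Poisson count law
  -- requires.
  set G : ℕ → SimpleFunc Plane ℝ≥0∞ := fun k =>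
    (SimpleFunc.eapprox g k).restrict (Metric.ball 0 k) with hG
  have hGapp : ∀ k x, G k x = (Metric.ball 0 (k : ℝ)).indicator (SimpleFunc.eapprox g k) x :=
    fun k x => SimpleFunc.restrict_apply _ Metric.isOpen_ball.measurableSet x
  have hGmono : ∀ x, Monotone fun k => G k x := by
    intro x i j hij
    simp only [hGapp]
    refine (indicator_le_indicator (SimpleFunc.monotone_eapprox g hij x)).trans ?_
    exact indicator_le_indicator_of_subset
      (Metric.ball_subset_ball (by exact_mod_cast hij)) (fun _ => zero_le) x
  have hGlim : ∀ x, Tendsto (fun k => G k x) atTop (𝓝 (g x)) := by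
    intro x
    refine (SimpleFunc.tendsto_eapprox hg x).congr' ?_
    obtain ⟨k₀, hk₀⟩ := exists_nat_gt (dist x 0)
    filter_upwards [eventually_ge_atTop k₀] with k hk
    rw [hGapp, indicator_of_mem]
    exact hk₀.trans_le (by exact_mod_cast hk)
  have hGsum : ∀ ω, Tendsto (fun k => ∑' n, G k (X n ω)) atTop (𝓝 (∑' n, g (X n ω))) := by
    intro ω
    -- The sum is an integral for counting measure, so monotone convergence applies.
    simp_rw [← lintegral_count]
    exact lintegral_tendsto_of_tendsto_of_monotone (fun k => measurable_from_top.aemeasurable)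
      (Eventually.of_forall fun n => hGmono _) (Eventually.of_forall fun n => hGlim _)
  have hL : Tendsto (fun k => ∫⁻ ω, expNeg (∑' n, G k (X n ω)) ∂μ) atTop
      (𝓝 (∫⁻ ω, expNeg (∑' n, g (X n ω)) ∂μ)) := by
    refine tendsto_lintegral_of_dominated_convergence (fun _ => 1) (fun k => ?_)
      (fun k => Eventually.of_forall fun ω => expNeg_le_one _) (by simp)
      (Eventually.of_forall fun ω => (continuous_expNeg.tendsto _).comp (hGsum ω))
    exact measurable_expNeg.comp
      (Measurable.tsum fun n => (G k).measurable.comp (h.measurable n))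
  have hR : Tendsto (fun k => expNeg (ENNReal.ofReal lam * ∫⁻ x, (1 - expNeg (G k x)))) atTop
      (𝓝 (expNeg (ENNReal.ofReal lam * ∫⁻ x, (1 - expNeg (g x))))) := by
    refine (continuous_expNeg.tendsto _).comp
      (ENNReal.Tendsto.const_mul ?_ (Or.inr ENNReal.ofReal_ne_top))
    refine lintegral_tendsto_of_tendsto_of_monotone (fun k => ?_)
      (Eventually.of_forall fun x i j hij => ?_) (Eventually.of_forall fun x => ?_)
    · exact (measurable_const.sub (measurable_expNeg.comp (G k).measurable)).aemeasurable
    · exact tsub_le_tsub_left (expNeg_antitone (hGmono x hij)) _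
    · exact ENNReal.Tendsto.sub tendsto_const_nhds ((continuous_expNeg.tendsto _).comp (hGlim x))
        (Or.inl ENNReal.one_ne_top)
  refine tendsto_nhds_unique hL (hR.congr fun k => (h.laplace_simpleFunc hlam (G k) ?_ ?_).symm)
  · intro x
    rw [hGapp]
    exact ((indicator_le_self _ _ _).trans_lt (SimpleFunc.eapprox_lt_top g k x)).ne
  · intro y _ hy
    refine ((measure_mono ?_).trans_lt (measure_ball_lt_top (x := (0 : Plane)) (r := k))).ne
    intro x hx
    by_contra hn
    have hx' : G k x = y := hx
    rw [hGapp, indicator_of_notMem hn] at hx'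
    exact hy hx'.symm

end Poisson

end HarvestAloha

namespace HarvestAloha
open Filter Topology

/-! ### Rayleigh fading -/

section Rayleigh

theorem lintegral_Ioi_mul_exp_neg_mul_sq {b y : ℝ} (hb : 0 < b) (hy : 0 ≤ y) :
    ∫⁻ x in Ioi y, ENNReal.ofReal (x * Real.exp (-b * x ^ 2)) =
      ENNReal.ofReal (Real.exp (-b * y ^ 2) / (2 * b)) := by
  have hd : ∀ x ∈ Ici y, HasDerivAt (fun x : ℝ => -(Real.exp (-b * x ^ 2) / (2 * b)))
      (x * Real.exp (-b * x ^ 2)) x := by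
    intro x _
    have h1 : HasDerivAt (fun x : ℝ => -b * x ^ 2) (-b * (2 * x)) x := by
      simpa using (hasDerivAt_pow 2 x).const_mul (-b)
    refine (h1.exp.div_const (2 * b)).fun_neg.congr_deriv ?_
    rw [neg_eq_iff_eq_neg, div_eq_iff (by positivity)]
    ring
  have hpos : ∀ x ∈ Ioi y, 0 ≤ x * Real.exp (-b * x ^ 2) := fun x hx =>
    mul_nonneg (hy.trans (le_of_lt hx)) (Real.exp_pos _).le
  have hlim : Tendsto (fun x : ℝ => -(Real.exp (-b * x ^ 2) / (2 * b))) atTop (𝓝 0) := by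
    have h1 : Tendsto (fun x : ℝ => -b * x ^ 2) atTop atBot :=
      (tendsto_pow_atTop two_ne_zero).const_mul_atTop_of_neg (by linarith)
    simpa using ((Real.tendsto_exp_atBot.comp h1).div_const (2 * b)).neg
  have hint := integrableOn_Ioi_deriv_of_nonneg' hd hpos hlim
  rw [← ofReal_integral_eq_lintegral_ofReal hint
    ((ae_restrict_iff' measurableSet_Ioi).2 (Eventually.of_forall hpos)),
    integral_Ioi_of_hasDerivAt_of_nonneg' hd hpos hlim]
  simp

theorem measurable_rayleighDensity (σ : ℝ) : Measurable fun x : ℝ =>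
    ENNReal.ofReal (if 0 ≤ x then x / σ ^ 2 * Real.exp (-x ^ 2 / (2 * σ ^ 2)) else 0) :=
  (Measurable.ite measurableSet_Ici (by fun_prop) measurable_const).ennreal_ofReal

theorem rayleighMeasure_Iic_zero (σ : ℝ) : rayleighMeasure σ (Iic 0) = 0 := by
  rw [rayleighMeasure, withDensity_apply _ measurableSet_Iic,
    setLIntegral_congr_fun (g := fun _ => 0) measurableSet_Iic, lintegral_zero]
  intro x hx
  rcases (mem_Iic.1 hx).lt_or_eq with h | rfl
  · simp [not_le.2 h]
  · simp

theorem rayleighMeasure_Ioi {σ y : ℝ} (hσ : 0 < σ) (hy : 0 ≤ y) :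
    rayleighMeasure σ (Ioi y) = ENNReal.ofReal (Real.exp (-(y ^ 2 / (2 * σ ^ 2)))) := by
  rw [rayleighMeasure, withDensity_apply _ measurableSet_Ioi,
    setLIntegral_congr_fun (g := fun x => ENNReal.ofReal (1 / σ ^ 2) *
      ENNReal.ofReal (x * Real.exp (-(1 / (2 * σ ^ 2)) * x ^ 2))) measurableSet_Ioi,
    lintegral_const_mul _ (by fun_prop), lintegral_Ioi_mul_exp_neg_mul_sq (by positivity) hy,
    ← ENNReal.ofReal_mul (by positivity)]
  · congr 1
    field_simp
  · intro x hx
    have hx0 : 0 ≤ x := hy.trans (le_of_lt hx)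
    simp only [if_pos hx0]
    rw [← ENNReal.ofReal_mul (by positivity)]
    congr 1
    rw [show -x ^ 2 / (2 * σ ^ 2) = -(1 / (2 * σ ^ 2)) * x ^ 2 by ring]
    ring

/-- The square of a Rayleigh variable is exponential with mean `2 * σ ^ 2`. The value `u = ∞` is
needed because the path loss factor is infinite at distance zero. -/
theorem lintegral_rayleighMeasure_expNeg {σ : ℝ} (hσ : 0 < σ) (u : ℝ≥0∞) :
    ∫⁻ x, expNeg (u * ENNReal.ofReal (x ^ 2)) ∂(rayleighMeasure σ) =
      (1 + ENNReal.ofReal (2 * σ ^ 2) * u)⁻¹ := by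
  have hm : Measurable fun x : ℝ => expNeg (u * ENNReal.ofReal (x ^ 2)) :=
    measurable_expNeg.comp ((by fun_prop : Measurable fun x : ℝ => ENNReal.ofReal (x ^ 2)).const_mul u)
  have hae : ∀ᵐ x ∂(rayleighMeasure σ), x ∈ Ioi (0 : ℝ) := by
    rw [ae_iff]
    convert! rayleighMeasure_Iic_zero σ using 2
    ext x; simp
  rw [← Measure.restrict_eq_self_of_ae_mem hae]
  rcases eq_or_ne u ∞ with rfl | hu
  · rw [setLIntegral_congr_fun (g := fun _ => 0) measurableSet_Ioi]
    · rw [ENNReal.mul_top (by simpa using by positivity)]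
      simp
    · intro x hx
      have : ENNReal.ofReal (x ^ 2) ≠ 0 := by
        have hx' : (0 : ℝ) < x := hx
        simpa using hx'.ne'
      simp only [ENNReal.top_mul this, expNeg_top]
  · lift u to NNReal using hu
    have hb : 0 < 1 / (2 * σ ^ 2) + (u : ℝ) := by positivity
    rw [rayleighMeasure, restrict_withDensity measurableSet_Ioi,
      lintegral_withDensity_eq_lintegral_mul _ (measurable_rayleighDensity σ) hm,
      setLIntegral_congr_fun (g := fun x => ENNReal.ofReal (1 / σ ^ 2) *
        ENNReal.ofReal (x * Real.exp (-(1 / (2 * σ ^ 2) + u) * x ^ 2))) measurableSet_Ioi,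
      lintegral_const_mul _ (by fun_prop), lintegral_Ioi_mul_exp_neg_mul_sq hb le_rfl,
      ← ENNReal.ofReal_mul (by positivity)]
    · have h1 : (0 : ℝ) < 1 + 2 * σ ^ 2 * u := by positivity
      have h2 : (1 : ℝ≥0∞) + ENNReal.ofReal (2 * σ ^ 2) * u = ENNReal.ofReal (1 + 2 * σ ^ 2 * u) := by
        rw [ENNReal.ofReal_add one_pos.le (by positivity),
          ENNReal.ofReal_mul (q := (u : ℝ)) (by positivity), ENNReal.ofReal_coe_nnreal,
          ENNReal.ofReal_one]
      rw [h2, ← ENNReal.ofReal_inv_of_pos h1]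
      congr 1
      simp only [ne_eq, OfNat.ofNat_ne_zero, not_false_eq_true, zero_pow, mul_zero, Real.exp_zero]
      field_simp
    · intro x hx
      have hx0 : (0 : ℝ) ≤ x := le_of_lt hx
      have h3 : (u : ℝ≥0∞) * ENNReal.ofReal (x ^ 2) = ENNReal.ofReal (u * x ^ 2) := by
        rw [ENNReal.ofReal_mul (by positivity)]; simp
      simp only [Pi.mul_apply, if_pos hx0]
      rw [h3, expNeg_ofReal (by positivity), ← ENNReal.ofReal_mul (by positivity),
        ← ENNReal.ofReal_mul (by positivity)]
      congr 1
      rw [mul_assoc, ← Real.exp_add, show -x ^ 2 / (2 * σ ^ 2) + -(u * x ^ 2) =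
        -(1 / (2 * σ ^ 2) + u) * x ^ 2 by ring]
      ring

/-- Tail of the signal power relative to an interference level `i`. -/
theorem rayleighMeasure_lt_div {σ D θ : ℝ} (hσ : 0 < σ) (hD : 0 < D) (hθ : 0 < θ) (i : ℝ≥0∞) :
    rayleighMeasure σ {x | ENNReal.ofReal θ < ENNReal.ofReal D * ENNReal.ofReal (x ^ 2) / i} =
      expNeg (ENNReal.ofReal (θ / D / (2 * σ ^ 2)) * i) := by
  have hc : 0 < θ / D / (2 * σ ^ 2) := by positivity
  rcases eq_or_ne i ∞ with rfl | hi
  · rw [ENNReal.mul_top (by simpa using hc)]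
    simp
  lift i to NNReal using hi
  have hr : ENNReal.ofReal (θ / D / (2 * σ ^ 2)) * i = ENNReal.ofReal (θ / D / (2 * σ ^ 2) * i) := by
    rw [ENNReal.ofReal_mul hc.le]; simp
  have hsq : (√(θ / D * i)) ^ 2 = θ / D * i := Real.sq_sqrt (by positivity)
  rw [hr, expNeg_ofReal (by positivity)]
  have := rayleighMeasure_Ioi hσ (Real.sqrt_nonneg (θ / D * i))
  rw [hsq] at this
  rw [show θ / D / (2 * σ ^ 2) * i = θ / D * i / (2 * σ ^ 2) by ring, ← this]
  refine measure_congr ?_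
  have hae : ∀ᵐ x ∂(rayleighMeasure σ), x ∈ Ioi (0 : ℝ) := by
    rw [ae_iff]
    convert! rayleighMeasure_Iic_zero σ using 2
    ext x; simp
  filter_upwards [hae] with x hx
  have hx0 : (0 : ℝ) < x := hx
  refine propext ?_
  change ENNReal.ofReal θ < ENNReal.ofReal D * ENNReal.ofReal (x ^ 2) / i ↔ √(θ / D * i) < x
  rw [← ENNReal.ofReal_mul hD.le, Real.sqrt_lt' hx0]
  -- Without interference the ratio is `∞`, and the event reduces to `0 < x`.
  rcases eq_or_ne i 0 with rfl | hi
  · have : 0 < D * x ^ 2 := by positivity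
    simp only [NNReal.coe_zero, mul_zero, ENNReal.coe_zero]
    rw [ENNReal.div_zero (by simpa using this)]
    simp [hx0]
  · have hi0 : 0 < (i : ℝ) := by positivity
    have hie : (i : ℝ≥0∞) = ENNReal.ofReal i := by simp
    rw [hie, ← ENNReal.ofReal_div_of_pos hi0, ENNReal.ofReal_lt_ofReal_iff (by positivity),
      lt_div_iff₀ hi0, div_mul_eq_mul_div, div_lt_iff₀ hD, mul_comm D]

end Rayleigh

/-! ### The planar path-loss integral -/

section PathLoss

theorem lintegral_Ioi_exp_neg_mul {b : ℝ} (hb : 0 < b) :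
    ∫⁻ s in Ioi (0 : ℝ), ENNReal.ofReal (Real.exp (-b * s)) = ENNReal.ofReal (1 / b) := by
  rw [← ofReal_integral_eq_lintegral_ofReal (integrableOn_exp_mul_Ioi (by linarith) 0)
    (Eventually.of_forall fun s => (Real.exp_pos _).le), integral_exp_mul_Ioi (by linarith)]
  congr 1
  simp

/-- The known integral over `ℂ`, transported along the isometry with the Euclidean plane. -/
theorem lintegral_plane_exp_neg_mul_rpow {α b : ℝ} (hα : 1 ≤ α) (hb : 0 < b) :
    ∫⁻ x : Plane, ENNReal.ofReal (Real.exp (-b * ‖x‖ ^ α)) =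
      ENNReal.ofReal (Real.pi * b ^ (-2 / α) * Real.Gamma (2 / α + 1)) := by
  have hmp := Complex.orthonormalBasisOneI.measurePreserving_repr
  have hα0 : 0 < α := by linarith
  have hval := Complex.integral_exp_neg_mul_rpow hα hb
  have hpos : 0 < Real.pi * b ^ (-2 / α) * Real.Gamma (2 / α + 1) :=
    mul_pos (mul_pos Real.pi_pos (Real.rpow_pos_of_pos hb _)) (Real.Gamma_pos_of_pos (by positivity))
  have hm : Measurable fun x : Plane => ENNReal.ofReal (Real.exp (-b * ‖x‖ ^ α)) := by fun_prop
  rw [← hmp.lintegral_comp hm]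
  simp only [LinearIsometryEquiv.norm_map]
  rw [← ofReal_integral_eq_lintegral_ofReal, hval]
  · exact Integrable.of_integral_ne_zero (by rw [hval]; exact hpos.ne')
  · exact Eventually.of_forall fun s => (Real.exp_pos _).le

theorem one_sub_inv_pathLoss {α t r : ℝ} (hα : 0 < α) (ht : 0 < t) (hr : 0 ≤ r) :
    1 - (1 + ENNReal.ofReal t * ENNReal.ofReal r ^ (-α))⁻¹ =
      ENNReal.ofReal (1 / (1 + r ^ α / t)) := by
  rcases hr.eq_or_lt with rfl | hr
  · rw [ENNReal.ofReal_zero, ENNReal.zero_rpow_of_neg (by linarith),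
      ENNReal.mul_top (by simpa using ht), Real.zero_rpow hα.ne']
    simp
  · have hra : 0 < r ^ α := Real.rpow_pos_of_pos hr α
    have hra' : 0 < r ^ (-α) := Real.rpow_pos_of_pos hr _
    have h1 : 0 < 1 + t * r ^ (-α) := by positivity
    rw [ENNReal.ofReal_rpow_of_pos hr, ← ENNReal.ofReal_mul ht.le, ← ENNReal.ofReal_one,
      ← ENNReal.ofReal_add one_pos.le (by positivity), ← ENNReal.ofReal_inv_of_pos h1,
      ← ENNReal.ofReal_sub _ (inv_pos.2 h1).le]
    congr 1
    rw [Real.rpow_neg hr.le]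
    field_simp
    ring

/-- The effective area lost to a single interferer under Rayleigh fading. -/
theorem lintegral_pathLoss {α t : ℝ} (hα : 2 < α) (ht : 0 < t) (rx : Plane) :
    ∫⁻ x : Plane, (1 - (1 + ENNReal.ofReal t * ENNReal.ofReal (dist rx x) ^ (-α))⁻¹) =
      ENNReal.ofReal (t ^ (2 / α) * kappa α) := by
  have hα0 : 0 < α := by linarith
  have h2α : 2 / α < 1 := (div_lt_one hα0).2 hα
  have h2α0 : 0 < 2 / α := by positivity
  have h1 : ∀ x : Plane, 1 - (1 + ENNReal.ofReal t * ENNReal.ofReal (dist rx x) ^ (-α))⁻¹ =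
      (fun x : Plane => ENNReal.ofReal (1 / (1 + ‖x‖ ^ α / t))) (x - rx) := by
    intro x
    rw [one_sub_inv_pathLoss hα0 ht dist_nonneg, dist_comm, dist_eq_norm]
  simp_rw [h1]
  rw [lintegral_sub_right_eq_self (fun x : Plane => ENNReal.ofReal (1 / (1 + ‖x‖ ^ α / t))) rx]
  -- Writing `1 / (1 + y)` as the integral of `exp (-s * (1 + y))` and applying Tonelli leaves
  -- `Γ(2/α + 1)` from the plane and `Γ(1 - 2/α)` from `s`; the latter converges because `α > 2`.
  have h2 : ∀ x : Plane, ENNReal.ofReal (1 / (1 + ‖x‖ ^ α / t)) =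
      ∫⁻ s in Ioi (0 : ℝ), ENNReal.ofReal (Real.exp (-s)) *
        ENNReal.ofReal (Real.exp (-(s / t) * ‖x‖ ^ α)) := by
    intro x
    have hx : 0 ≤ ‖x‖ ^ α := Real.rpow_nonneg (norm_nonneg x) α
    rw [← lintegral_Ioi_exp_neg_mul (by positivity : 0 < 1 + ‖x‖ ^ α / t)]
    refine lintegral_congr fun s => ?_
    rw [← ENNReal.ofReal_mul (Real.exp_pos _).le, ← Real.exp_add]
    congr 2
    ring
  simp_rw [h2]
  rw [lintegral_lintegral_swap (by fun_prop)]
  have h3 : ∀ s ∈ Ioi (0 : ℝ), ∫⁻ x : Plane, ENNReal.ofReal (Real.exp (-s)) *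
        ENNReal.ofReal (Real.exp (-(s / t) * ‖x‖ ^ α)) =
      ENNReal.ofReal (Real.pi * t ^ (2 / α) * Real.Gamma (2 / α + 1)) *
        ENNReal.ofReal (Real.exp (-s) * s ^ ((1 - 2 / α) - 1)) := by
    intro s hs
    have hs0 : 0 < s := hs
    have hG := Real.Gamma_pos_of_pos (by positivity : 0 < 2 / α + 1)
    rw [lintegral_const_mul _ (by fun_prop),
      lintegral_plane_exp_neg_mul_rpow (by linarith) (div_pos hs0 ht),
      ← ENNReal.ofReal_mul (Real.exp_pos _).le, ← ENNReal.ofReal_mul (by positivity)]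
    congr 1
    rw [Real.div_rpow hs0.le ht.le, show 1 - 2 / α - 1 = -2 / α by ring,
      show -2 / α = -(2 / α) by ring, Real.rpow_neg ht.le]
    have := Real.rpow_pos_of_pos ht (2 / α)
    field_simp
  rw [setLIntegral_congr_fun measurableSet_Ioi h3, lintegral_const_mul _ (by fun_prop),
    ← ofReal_integral_eq_lintegral_ofReal (Real.GammaIntegral_convergent (by linarith))
    ((ae_restrict_iff' measurableSet_Ioi).2 (Eventually.of_forall fun s hs =>
      mul_nonneg (Real.exp_pos _).le (Real.rpow_nonneg (le_of_lt hs) _))),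
    ← Real.Gamma_eq_integral (by linarith), ← ENNReal.ofReal_mul (by
      have := Real.Gamma_pos_of_pos (by positivity : 0 < 2 / α + 1)
      positivity)]
  congr 1
  rw [Real.Gamma_add_one h2α0.ne', kappa]
  have := Real.Gamma_mul_Gamma_one_sub (2 / α)
  rw [show Real.pi * (2 / α) = 2 * Real.pi / α by ring] at this
  rw [show Real.pi * t ^ (2 / α) * (2 / α * Real.Gamma (2 / α)) * Real.Gamma (1 - 2 / α) =
    Real.pi * t ^ (2 / α) * (2 / α) * (Real.Gamma (2 / α) * Real.Gamma (1 - 2 / α)) by ring, this]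
  simp only [div_eq_mul_inv, mul_inv]
  ring

theorem kappa_pos {α : ℝ} (hα : 2 < α) : 0 < kappa α := by
  have hα0 : 0 < α := by linarith
  have : 0 < Real.sin (2 * Real.pi / α) :=
    Real.sin_pos_of_pos_of_lt_pi (by positivity)
      ((div_lt_iff₀ hα0).2 (by nlinarith [Real.pi_pos]))
  unfold kappa
  positivity

end PathLoss

end HarvestAloha

/-! ### Stationary law of the energy queue -/

namespace HarvestAloha

/-- Ratio of consecutive geometric sums is strictly increasing in the common ratio. -/
theorem geom_sum_ratio_lt {B : ℕ} (hB : 1 ≤ B) {x y : ℝ} (hx : 0 ≤ x) (hxy : x < y) :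
    (∑ i ∈ Finset.range (B + 1), x ^ i) * ∑ i ∈ Finset.range B, y ^ i <
      (∑ i ∈ Finset.range (B + 1), y ^ i) * ∑ i ∈ Finset.range B, x ^ i := by
  -- The product of the two shorter sums cancels, leaving the top powers. Termwise, `x ^ B * y ^ i`
  -- and `y ^ B * x ^ i` share the factor `(x * y) ^ i`.
  have h : x ^ B * ∑ i ∈ Finset.range B, y ^ i < y ^ B * ∑ i ∈ Finset.range B, x ^ i := by
    rw [Finset.mul_sum, Finset.mul_sum]
    refine Finset.sum_lt_sum (fun i hi => ?_) ⟨0, by simp; omega, ?_⟩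
    · obtain ⟨k, rfl⟩ := Nat.exists_eq_add_of_le (Finset.mem_range.1 hi).le
      have : x ^ k ≤ y ^ k := pow_le_pow_left₀ hx hxy.le k
      have h2 : 0 ≤ x ^ i * y ^ i := mul_nonneg (pow_nonneg hx _) (pow_nonneg (hx.trans hxy.le) _)
      rw [pow_add, pow_add]
      nlinarith [mul_le_mul_of_nonneg_left this h2]
    · simpa using pow_lt_pow_left₀ hxy hx (by omega : B ≠ 0)
  rw [Finset.sum_range_succ, Finset.sum_range_succ]
  nlinarith

section Queue

variable {p q : ℝ} {B : ℕ} {ν : Fin (B + 1) → ℝ}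

theorem IsStationary.nonemptyProb_eq (h : IsStationary p q ν) : nonemptyProb ν = 1 - ν 0 := by
  have h1 : ∑ i, ν i = 1 := h.1.2
  rw [← Finset.add_sum_erase _ _ (Finset.mem_univ 0)] at h1
  have : nonemptyProb ν = ∑ i ∈ Finset.univ.erase 0, ν i := by
    unfold nonemptyProb
    congr 1
    ext i
    simp
  linarith

theorem IsStationary.nonemptyProb_nonneg (h : IsStationary p q ν) : 0 ≤ nonemptyProb ν :=
  Finset.sum_nonneg fun i _ => h.1.1 i

theorem IsStationary.nonemptyProb_le_one (h : IsStationary p q ν) : nonemptyProb ν ≤ 1 := by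
  rw [h.nonemptyProb_eq]
  linarith [h.1.1 0]

/-- The law `ν` read as a function on `ℕ`, zero above `B`. -/
noncomputable def extendLaw (ν : Fin (B + 1) → ℝ) (i : ℕ) : ℝ :=
  if h : i < B + 1 then ν ⟨i, h⟩ else 0

theorem extendLaw_eq (i : Fin (B + 1)) : extendLaw ν i = ν i := dif_pos i.2

theorem extendLaw_of_lt {i : ℕ} (h : B < i) : extendLaw ν i = 0 := by
  simp [extendLaw]; omega

/-- Balance equation at level `j`. -/
theorem IsStationary.balance (h : IsStationary p q ν) (j : ℕ) (hj : j ≤ B) :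
    (if j = 0 then 0 else extendLaw ν (j - 1) * birthProb p q (j - 1)) +
      extendLaw ν (j + 1) * deathProb p q (j + 1) =
    extendLaw ν j * ((if j < B then birthProb p q j else 0) + deathProb p q j) := by
  have h2 := congrFun h.2 ⟨j, by omega⟩
  have key : ∀ i : ℕ, i < B + 1 → ∀ hi : i < B + 1,
      ν ⟨i, hi⟩ * queueMatrix p q B ⟨i, hi⟩ ⟨j, by omega⟩ =
      (if j = i + 1 then extendLaw ν i * birthProb p q i else 0) +
      (if j + 1 = i then extendLaw ν i * deathProb p q i else 0) +
      (if i = j then extendLaw ν j *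
        (1 - (if j < B then birthProb p q j else 0) - deathProb p q j) else 0) := by
    intro i hi hi'
    have : extendLaw ν i = ν ⟨i, hi⟩ := by simp [extendLaw, hi]
    simp only [queueMatrix, Fin.mk.injEq]
    by_cases h1 : j = i + 1
    · have h2 : ¬ j + 1 = i := by omega
      have h3 : ¬ i = j := by omega
      simp only [if_pos h1, if_neg h2, if_neg h3, this, add_zero]
    by_cases h2 : j + 1 = i
    · have h3 : ¬ i = j := by omega
      simp [h1, h2, this, h3]
    by_cases h3 : i = j
    · subst h3; simp [this]
    simp [h1, h2, h3]
  have e : (ν ᵥ* queueMatrix p q B) ⟨j, by omega⟩ = ∑ i ∈ Finset.range (B + 1),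
      ((if j = i + 1 then extendLaw ν i * birthProb p q i else 0) +
      (if j + 1 = i then extendLaw ν i * deathProb p q i else 0) +
      (if i = j then extendLaw ν j *
        (1 - (if j < B then birthProb p q j else 0) - deathProb p q j) else 0)) := by
    rw [Finset.sum_range, Matrix.vecMul_eq_sum, Finset.sum_apply]
    exact Finset.sum_congr rfl fun (i : Fin (B + 1)) _ => key i i.2 i.2
  rw [e, Finset.sum_add_distrib, Finset.sum_add_distrib, Finset.sum_ite_eq, Finset.sum_ite_eq',
    if_pos (Finset.mem_range.2 (by omega : j < B + 1))] at h2
  have e1 : ∑ i ∈ Finset.range (B + 1), (if j = i + 1 then extendLaw ν i * birthProb p q i else 0)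
      = if j = 0 then 0 else extendLaw ν (j - 1) * birthProb p q (j - 1) := by
    split_ifs with h0
    · exact Finset.sum_eq_zero fun i _ => if_neg (by omega)
    · rw [Finset.sum_eq_single (j - 1)]
      · rw [if_pos (by omega)]
      · intro i _ hi; exact if_neg (by omega)
      · intro hi; simp at hi; omega
  have e2 : (if j + 1 ∈ Finset.range (B + 1) then extendLaw ν (j + 1) * deathProb p q (j + 1)
      else 0) = extendLaw ν (j + 1) * deathProb p q (j + 1) := by
    split_ifs with h0
    · rfl
    · rw [extendLaw_of_lt (by simpa using h0), zero_mul]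
  have e3 : extendLaw ν j = ν ⟨j, by omega⟩ := dif_pos (by omega)
  rw [e1, e2, ← e3] at h2
  linarith

/-- Detailed balance between neighbouring levels. -/
theorem IsStationary.detailed_balance (h : IsStationary p q ν) (j : ℕ) (hj : j < B) :
    extendLaw ν (j + 1) * deathProb p q (j + 1) = extendLaw ν j * birthProb p q j := by
  -- Balance at `j + 1` minus detailed balance at `j` leaves the flow across the next edge.
  induction j with
  | zero =>
    have := h.balance 0 (by omega)
    simpa [hj, deathProb] using this
  | succ j ih =>
    have h1 := ih (by omega)
    have := h.balance (j + 1) (by omega)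
    simp only [Nat.succ_ne_zero, if_false, Nat.add_sub_cancel, if_pos hj] at this
    linarith

/-- An empty battery cannot transmit, so the first ratio lacks the factor `1 - q` of the later ones.
-/
theorem IsStationary.extendLaw_succ (h : IsStationary p q ν) (hd : q * (1 - p) ≠ 0) (j : ℕ)
    (hj : j < B) :
    extendLaw ν (j + 1) =
      extendLaw ν 0 * (p / (q * (1 - p))) * (p * (1 - q) / (q * (1 - p))) ^ j := by
  induction j with
  | zero =>
    have := h.detailed_balance 0 hj
    simp only [deathProb, birthProb, Nat.succ_ne_zero, if_false, if_true, zero_add] at this ⊢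
    rw [pow_zero, mul_one, ← mul_div_assoc, eq_div_iff hd, this]
  | succ j ih =>
    have := h.detailed_balance (j + 1) hj
    simp only [deathProb, birthProb, Nat.succ_ne_zero, if_false] at this
    rw [ih (by omega)] at this
    rw [← eq_div_iff hd] at this
    rw [this, pow_succ]
    ring

/-- Closed form of the throughput `q * r`. -/
theorem IsStationary.throughput_eq (h : IsStationary p q ν) (hp : 0 < p) (hp1 : p < 1) (hq : 0 < q)
    (hq1 : q ≤ 1) (hB : 1 ≤ B) :
    q * nonemptyProb ν = p * (∑ i ∈ Finset.range B, (p * (1 - q) / (q * (1 - p))) ^ i) /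
      (p * (∑ i ∈ Finset.range B, (p * (1 - q) / (q * (1 - p))) ^ i) +
      (1 - p) * ∑ i ∈ Finset.range (B + 1), (p * (1 - q) / (q * (1 - p))) ^ i) := by
  have hd : 0 < q * (1 - p) := mul_pos hq (by linarith)
  set ρ := p * (1 - q) / (q * (1 - p)) with hρ
  have hρ0 : 0 ≤ ρ := div_nonneg (mul_nonneg hp.le (by linarith)) hd.le
  have hS1 : 0 < ∑ i ∈ Finset.range B, ρ ^ i := by
    obtain ⟨m, rfl⟩ := Nat.exists_eq_add_of_le' hB
    rw [Finset.sum_range_succ']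
    have := Finset.sum_nonneg fun i (_ : i ∈ Finset.range m) => pow_nonneg hρ0 (i + 1)
    simp; linarith
  have hr : nonemptyProb ν = ν 0 * (p / (q * (1 - p))) * ∑ i ∈ Finset.range B, ρ ^ i := by
    have h1 : ∑ i, ν i = 1 := h.1.2
    have h2 : ∑ i, ν i = ∑ i ∈ Finset.range (B + 1), extendLaw ν i := by
      rw [Finset.sum_range]; simp only [extendLaw_eq]
    rw [Finset.sum_range_succ'] at h2
    have h0 : extendLaw ν 0 = ν 0 := extendLaw_eq 0
    have h3 : ∑ i ∈ Finset.range B, extendLaw ν (i + 1) =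
        ν 0 * (p / (q * (1 - p))) * ∑ i ∈ Finset.range B, ρ ^ i := by
      rw [Finset.mul_sum]
      exact Finset.sum_congr rfl fun i hi => by
        rw [h.extendLaw_succ hd.ne' i (Finset.mem_range.1 hi), h0]
    linarith [h.nonemptyProb_eq]
  have hr' := h.nonemptyProb_eq
  have hT : ∑ i ∈ Finset.range (B + 1), ρ ^ i = 1 + ρ * ∑ i ∈ Finset.range B, ρ ^ i := by
    rw [Finset.sum_range_succ', Finset.mul_sum, add_comm]
    simp [pow_succ, mul_comm]
  rw [hT]
  generalize (∑ i ∈ Finset.range B, ρ ^ i) = S at *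
  have hρ' : ρ * (q * (1 - p)) = p * (1 - q) := div_mul_cancel₀ _ hd.ne'
  have hden : 0 < p * S + (1 - p) * (1 + ρ * S) := by
    have : 0 ≤ ρ * S := mul_nonneg hρ0 hS1.le
    have := mul_pos hp hS1
    nlinarith
  rw [eq_div_iff hden.ne']
  -- Normalization eliminates `ν 0`; what remains is linear in the nonempty probability.
  have hr2 : nonemptyProb ν * (q * (1 - p)) = (1 - nonemptyProb ν) * p * S := by
    have : ν 0 = 1 - nonemptyProb ν := by linarith
    rw [this] at hr
    have hc : p / (q * (1 - p)) * (q * (1 - p)) = p := div_mul_cancel₀ _ hd.ne'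
    linear_combination (q * (1 - p)) * hr + (1 - nonemptyProb ν) * S * hc
  generalize nonemptyProb ν = r at *
  linear_combination hr2 + r * S * hρ'

/-- At `p = 1` nothing moves down, so detailed balance at level `0` forces `ν 0 = 0`. The closed
form, with `1 - p` in a denominator, excludes this case. -/
theorem IsStationary.nonemptyProb_of_one (h : IsStationary 1 q ν) (hB : 1 ≤ B) :
    nonemptyProb ν = 1 := by
  have := h.detailed_balance 0 hB
  have h0 : extendLaw ν 0 = ν 0 := extendLaw_eq 0
  simp [deathProb, birthProb, h0] at this
  rw [h.nonemptyProb_eq, ← this, sub_zero]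

theorem IsStationary.nonemptyProb_of_access_one (h : IsStationary p 1 ν) (hp : 0 < p) (hp1 : p ≤ 1)
    (hB : 1 ≤ B) : nonemptyProb ν = p := by
  rcases hp1.lt_or_eq with hp1 | rfl
  · have := h.throughput_eq hp hp1 one_pos le_rfl hB
    rw [one_mul] at this
    rw [this]
    obtain ⟨m, rfl⟩ := Nat.exists_eq_add_of_le' hB
    simp [Finset.sum_range_succ']
  · exact h.nonemptyProb_of_one hB

end Queue

/-! ### Monotonicity and range of the throughput -/

section Throughput

variable {p : ℝ} {B : ℕ} {ν : ℝ → Fin (B + 1) → ℝ}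

/-- For `p < 1` the ratio `ρ` decreases in `q`, and the throughput decreases in the quotient of the
longer geometric sum by the shorter, which increases with `ρ`. The point `q = 0`, where `ρ` has a
zero denominator, is compared directly. -/
theorem throughput_strictMonoOn (hp : 0 < p) (hp1 : p ≤ 1) (hB : 1 ≤ B)
    (hν : ∀ q ∈ Icc (0 : ℝ) 1, IsStationary p q (ν q)) :
    StrictMonoOn (fun q => q * nonemptyProb (ν q)) (Icc 0 1) := by
  intro x hx y hy hxy
  have hy0 : 0 < y := hx.1.trans_lt hxy
  rcases hp1.lt_or_eq with hp1 | rfl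
  · set ρ : ℝ → ℝ := fun q => p * (1 - q) / (q * (1 - p)) with hρ
    have hpos : ∀ q, 0 < q → q ≤ 1 → 0 ≤ ρ q := fun q h0 h1 =>
      div_nonneg (mul_nonneg hp.le (by linarith)) (mul_nonneg h0.le (by linarith))
    have hS1 : ∀ q, 0 < q → q ≤ 1 → 0 < ∑ i ∈ Finset.range B, ρ q ^ i := by
      intro q h0 h1
      obtain ⟨m, rfl⟩ := Nat.exists_eq_add_of_le' hB
      rw [Finset.sum_range_succ']
      have := Finset.sum_nonneg fun i (_ : i ∈ Finset.range m) => pow_nonneg (hpos q h0 h1) (i + 1)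
      simp; linarith
    have hS2 : ∀ q, 0 < q → q ≤ 1 → 0 ≤ ∑ i ∈ Finset.range (B + 1), ρ q ^ i := fun q h0 h1 =>
      Finset.sum_nonneg fun i _ => pow_nonneg (hpos q h0 h1) i
    have hden : ∀ q, 0 < q → q ≤ 1 → 0 < p * (∑ i ∈ Finset.range B, ρ q ^ i) +
        (1 - p) * ∑ i ∈ Finset.range (B + 1), ρ q ^ i := fun q h0 h1 =>
      add_pos_of_pos_of_nonneg (mul_pos hp (hS1 q h0 h1))
        (mul_nonneg (by linarith) (hS2 q h0 h1))
    have hfy := (hν y hy).throughput_eq hp hp1 hy0 hy.2 hB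
    rcases hx.1.eq_or_lt with rfl | hx0
    · simp only [zero_mul]
      rw [hfy]
      exact div_pos (mul_pos hp (hS1 y hy0 hy.2)) (hden y hy0 hy.2)
    · have hfx := (hν x hx).throughput_eq hp hp1 hx0 hx.2 hB
      simp only
      rw [hfx, hfy, div_lt_div_iff₀ (hden x hx0 hx.2) (hden y hy0 hy.2)]
      have hlt : ρ y < ρ x := by
        rw [hρ]
        simp only
        rw [div_lt_div_iff₀ (mul_pos hy0 (by linarith)) (mul_pos hx0 (by linarith))]
        have : 0 < p * (1 - p) * (y - x) :=
          mul_pos (mul_pos hp (by linarith)) (by linarith)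
        nlinarith
      have key := geom_sum_ratio_lt hB (hpos y hy0 hy.2) hlt
      have : 0 < p * (1 - p) := mul_pos hp (by linarith)
      nlinarith [mul_lt_mul_of_pos_left key this]
  · simpa [(hν x hx).nonemptyProb_of_one hB, (hν y hy).nonemptyProb_of_one hB] using hxy

theorem throughput_continuousOn (hp : 0 < p) (hp1 : p ≤ 1) (hB : 1 ≤ B)
    (hν : ∀ q ∈ Icc (0 : ℝ) 1, IsStationary p q (ν q)) :
    ContinuousOn (fun q => q * nonemptyProb (ν q)) (Ioc 0 1) := by
  rcases hp1.lt_or_eq with hp1 | rfl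
  · refine ContinuousOn.congr (f := fun q => _) ?_ fun q hq =>
      (hν q ⟨hq.1.le, hq.2⟩).throughput_eq hp hp1 hq.1 hq.2 hB
    have hρ : ContinuousOn (fun q : ℝ => p * (1 - q) / (q * (1 - p))) (Ioc 0 1) := by
      refine ContinuousOn.div (by fun_prop) (by fun_prop) fun q hq => ?_
      exact (mul_pos hq.1 (by linarith)).ne'
    refine ContinuousOn.div (by fun_prop) (by fun_prop) fun q hq => ?_
    have hpos : 0 ≤ p * (1 - q) / (q * (1 - p)) :=
      div_nonneg (mul_nonneg hp.le (by linarith [hq.2])) (mul_nonneg hq.1.le (by linarith))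
    have h1 : 0 < ∑ i ∈ Finset.range (B + 1), (p * (1 - q) / (q * (1 - p))) ^ i := by
      rw [Finset.sum_range_succ']
      have := Finset.sum_nonneg fun i (_ : i ∈ Finset.range B) => pow_nonneg hpos (i + 1)
      rw [pow_zero]; linarith
    have h2 : 0 ≤ ∑ i ∈ Finset.range B, (p * (1 - q) / (q * (1 - p))) ^ i :=
      Finset.sum_nonneg fun i _ => pow_nonneg hpos i
    exact (add_pos_of_nonneg_of_pos (mul_nonneg hp.le h2) (mul_pos (by linarith) h1)).ne'
  · exact continuousOn_id.congr fun q hq => by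
      simp [(hν q ⟨hq.1.le, hq.2⟩).nonemptyProb_of_one hB]

/-- The throughput at `c` is at most `c`, so the intermediate value theorem on `[c, 1]` suffices and
continuity at `0` is not needed. -/
theorem exists_throughput_eq (hp : 0 < p) (hp1 : p ≤ 1) (hB : 1 ≤ B)
    (hν : ∀ q ∈ Icc (0 : ℝ) 1, IsStationary p q (ν q)) {c : ℝ} (hc : 0 < c) (hcp : c ≤ p) :
    ∃ x ∈ Icc (0 : ℝ) 1, x * nonemptyProb (ν x) = c := by
  have hc1 : c ≤ 1 := hcp.trans hp1
  have := intermediate_value_Icc hc1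
    ((throughput_continuousOn hp hp1 hB hν).mono fun x hx => ⟨hc.trans_le hx.1, hx.2⟩)
  obtain ⟨x, hx, h⟩ := this (show c ∈ _ from
    ⟨mul_le_of_le_one_right hc.le (hν c ⟨hc.le, hc1⟩).nonemptyProb_le_one, by
      rw [one_mul, (hν 1 (by simp)).nonemptyProb_of_access_one hp hp1 hB]; exact hcp⟩)
  exact ⟨x, ⟨hc.le.trans hx.1, hx.2⟩, h⟩

end Throughput

end HarvestAloha

/-! ### Distribution of the signal-to-interference ratio -/

namespace HarvestAloha
open Filter Topology

namespace Network

open Classical in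
/-- Interference power of transmitters with locations `x` and marks `m`. -/
noncomputable def interferenceOf {B : ℕ} (α : ℝ) (rx : Plane) (x : ℕ → Plane)
    (m : ℕ → ℝ × Fin (B + 1) × Bool) : ℝ≥0∞ :=
  ∑' n, (if 1 ≤ ((m n).2.1 : ℕ) ∧ (m n).2.2 = true then 1 else 0) *
    (ENNReal.ofReal (dist rx (x n))) ^ (-α) * ENNReal.ofReal ((m n).1 ^ 2)

/-- Laplace transform, at `c`, of the interference from one transmitter at `x` that is active with
probability `a`. -/
noncomputable def nodeLaplace (σ α : ℝ) (a c : ℝ≥0∞) (rx x : Plane) : ℝ≥0∞ :=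
  (1 - a) + a * (1 + ENNReal.ofReal (2 * σ ^ 2) * (c * ENNReal.ofReal (dist rx x) ^ (-α)))⁻¹

theorem measurable_pathLoss (α : ℝ) (rx : Plane) :
    Measurable fun x : Plane => ENNReal.ofReal (dist rx x) ^ (-α) := by
  fun_prop

theorem measurable_nodeLaplace (σ α : ℝ) (a c : ℝ≥0∞) (rx : Plane) :
    Measurable (nodeLaplace σ α a c rx) := by
  unfold nodeLaplace
  exact (((((measurable_pathLoss α rx).const_mul c).const_mul _).const_add 1).inv.const_mul
    a).const_add _

theorem nodeLaplace_le_one {σ α : ℝ} {a c : ℝ≥0∞} (ha : a ≤ 1) (rx x : Plane) :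
    nodeLaplace σ α a c rx x ≤ 1 := by
  unfold nodeLaplace
  set v := (1 + ENNReal.ofReal (2 * σ ^ 2) * (c * ENNReal.ofReal (dist rx x) ^ (-α)))⁻¹
  have hv : v ≤ 1 := ENNReal.inv_le_one.2 le_self_add
  calc (1 - a) + a * v ≤ (1 - a) + a * 1 := by gcongr
    _ = 1 := by rw [mul_one, tsub_add_cancel_of_le ha]

/-- Thinning: the deficit from `1` is linear in the activity probability `a`. -/
theorem one_sub_nodeLaplace {σ α : ℝ} {a c : ℝ≥0∞} (ha : a ≤ 1) (rx x : Plane) :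
    1 - nodeLaplace σ α a c rx x =
      a * (1 - (1 + ENNReal.ofReal (2 * σ ^ 2) * (c * ENNReal.ofReal (dist rx x) ^ (-α)))⁻¹) := by
  unfold nodeLaplace
  set v := (1 + ENNReal.ofReal (2 * σ ^ 2) * (c * ENNReal.ofReal (dist rx x) ^ (-α)))⁻¹
  have hv : v ≤ 1 := ENNReal.inv_le_one.2 le_self_add
  have h : 1 = a * (1 - v) + ((1 - a) + a * v) := by
    rw [add_comm, add_assoc, ← mul_add, add_tsub_cancel_of_le hv, mul_one,
      tsub_add_cancel_of_le ha]
  exact ENNReal.sub_eq_of_eq_add (ne_top_of_le_ne_top ENNReal.one_ne_top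
    (nodeLaplace_le_one (σ := σ) (α := α) (c := c) ha rx x)) h

variable {B : ℕ} {Ω : Type*} {N : Network B Ω}

open Classical in
theorem interference_eq (α : ℝ) (rx : Plane) (ω : Ω) :
    N.interference α rx ω = interferenceOf α rx (fun n => N.loc n ω) (fun n => N.mark n ω) := by
  unfold interference interferenceOf
  refine tsum_congr fun n => ?_
  congr 2
  exact if_congr Iff.rfl rfl rfl

theorem measurable_interferenceOf (α : ℝ) (rx : Plane) :
    Measurable fun z : (ℕ → Plane) × (ℕ → ℝ × Fin (B + 1) × Bool) =>
      interferenceOf α rx z.1 z.2 := by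
  classical
  unfold interferenceOf
  refine Measurable.tsum fun n => ?_
  have hm : Measurable fun z : (ℕ → Plane) × (ℕ → ℝ × Fin (B + 1) × Bool) => z.2 n := by fun_prop
  have hx : Measurable fun z : (ℕ → Plane) × (ℕ → ℝ × Fin (B + 1) × Bool) => z.1 n := by fun_prop
  refine Measurable.mul (Measurable.mul ?_ ((measurable_pathLoss α rx).comp hx)) ?_
  · exact (measurable_of_finite fun e : Fin (B + 1) × Bool =>
      (if 1 ≤ (e.1 : ℕ) ∧ e.2 = true then (1 : ℝ≥0∞) else 0)).comp hm.snd
  · exact (hm.fst.pow_const 2).ennreal_ofReal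

variable [MeasurableSpace Ω] {μ : Measure Ω} {lam σ q : ℝ} {ν : Fin (B + 1) → ℝ}

theorem IsModel.measurable_mark (h : N.IsModel μ lam σ q ν) (n : ℕ) : Measurable (N.mark n) :=
  (h.gain_meas n).prodMk ((h.energy_meas n).prodMk (h.attempt_meas n))

theorem IsModel.measure_active (h : N.IsModel μ lam σ q ν) (n : ℕ) (hq : 0 ≤ q) :
    μ {ω | N.active n ω} = ENNReal.ofReal (q * nonemptyProb ν) := by
  have := h.isProb
  have h1 : {ω | N.active n ω} = N.energy n ⁻¹' {i | i ≠ 0} ∩ N.attempt n ⁻¹' {true} := by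
    ext ω
    simp [active, Nat.one_le_iff_ne_zero]
  have hpos : ∀ i, 0 ≤ ν i := fun i => h.energy_law n i ▸ measureReal_nonneg
  have h2 : μ (N.energy n ⁻¹' {i | i ≠ 0}) = ENNReal.ofReal (nonemptyProb ν) := by
    have := sum_measure_preimage_singleton (μ := μ) (f := N.energy n)
      (Finset.univ.filter (· ≠ 0)) fun i _ => h.energy_meas n (measurableSet_singleton i)
    rw [Finset.coe_filter_univ] at this
    rw [← this, nonemptyProb, ENNReal.ofReal_sum_of_nonneg fun i _ => hpos i]
    refine Finset.sum_congr rfl fun i _ => ?_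
    rw [← h.energy_law n i, ofReal_measureReal]
    rfl
  have h3 : μ (N.attempt n ⁻¹' {true}) = ENNReal.ofReal q := by
    rw [← h.attempt_law n, ofReal_measureReal]
    rfl
  rw [h1, (h.energy_attempt_indep n).measure_inter_preimage_eq_mul _ _
    (Set.toFinite _).measurableSet (measurableSet_singleton _), h2, h3, ENNReal.ofReal_mul hq,
    mul_comm]

open Classical in
theorem IsModel.lintegral_mark (h : N.IsModel μ lam σ q ν) (hσ : 0 < σ) (hq : 0 ≤ q) (α : ℝ)
    (c : ℝ≥0∞) (rx x : Plane) (n : ℕ) :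
    ∫⁻ ω, expNeg (c * ((if N.active n ω then 1 else 0) *
      (ENNReal.ofReal (dist rx x)) ^ (-α) * ENNReal.ofReal (N.gain n ω ^ 2))) ∂μ =
    nodeLaplace σ α (ENNReal.ofReal (q * nonemptyProb ν)) c rx x := by
  have := h.isProb
  set u := c * (ENNReal.ofReal (dist rx x)) ^ (-α) with hu
  set S : Set (Fin (B + 1) × Bool) := {e | 1 ≤ (e.1 : ℕ) ∧ e.2 = true} with hS
  have hE : Measurable fun ω => (N.energy n ω, N.attempt n ω) :=
    (h.energy_meas n).prodMk (h.attempt_meas n)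
  have hSm : MeasurableSet S := (Set.toFinite _).measurableSet
  have hA : MeasurableSet {ω | N.active n ω} := hE hSm
  have hF : Measurable fun g : ℝ => expNeg (u * ENNReal.ofReal (g ^ 2)) :=
    measurable_expNeg.comp ((by fun_prop : Measurable fun x : ℝ => ENNReal.ofReal (x ^ 2)).const_mul u)
  have h1 : ∀ ω, expNeg (c * ((if N.active n ω then 1 else 0) *
      (ENNReal.ofReal (dist rx x)) ^ (-α) * ENNReal.ofReal (N.gain n ω ^ 2))) =
      {ω | N.active n ω}ᶜ.indicator 1 ω +
        expNeg (u * ENNReal.ofReal (N.gain n ω ^ 2)) * {ω | N.active n ω}.indicator 1 ω := by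
    intro ω
    by_cases ha : N.active n ω
    · simp [ha, hu, mul_assoc]
    · simp [ha]
  simp_rw [h1]
  have hI := lintegral_mul_eq_lintegral_mul_lintegral_of_indepFun (μ := μ)
    (f := fun ω => expNeg (u * ENNReal.ofReal (N.gain n ω ^ 2)))
    (g := {ω | N.active n ω}.indicator 1) (hF.comp (h.gain_meas n))
    (measurable_one.indicator hA)
    ((h.gain_indep n).comp hF (measurable_one.indicator hSm : Measurable (S.indicator 1)))
  rw [lintegral_add_left (measurable_one.indicator hA.compl), lintegral_indicator_one hA.compl,
    prob_compl_eq_one_sub hA]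
  simp only [Pi.mul_apply] at hI
  rw [hI, lintegral_indicator_one hA, h.measure_active n hq,
    ← lintegral_map hF (h.gain_meas n), h.gain_law n, lintegral_rayleighMeasure_expNeg hσ,
    nodeLaplace]
  congr 1
  exact mul_comm _ _

/-- With the locations frozen, independent marks give a product of `nodeLaplace` factors. Its
logarithm is additive over the points, ready for the Poisson average. -/
theorem IsModel.lintegral_marks (h : N.IsModel μ lam σ q ν) (hσ : 0 < σ) (hq : 0 ≤ q)
    (ha : ENNReal.ofReal (q * nonemptyProb ν) ≤ 1) (α : ℝ) (c : ℝ≥0∞) (rx : Plane)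
    (x : ℕ → Plane) :
    ∫⁻ ω, expNeg (c * interferenceOf α rx x (fun n => N.mark n ω)) ∂μ =
      expNeg (∑' n, (-ENNReal.log
        (nodeLaplace σ α (ENNReal.ofReal (q * nonemptyProb ν)) c rx (x n))).toENNReal) := by
  classical
  have := h.isProb
  set T : ℕ → ℝ × Fin (B + 1) × Bool → ℝ≥0∞ := fun n m =>
    (if 1 ≤ (m.2.1 : ℕ) ∧ m.2.2 = true then 1 else 0) *
      (ENNReal.ofReal (dist rx (x n))) ^ (-α) * ENNReal.ofReal (m.1 ^ 2) with hT
  have hTm : ∀ n, Measurable fun m => expNeg (c * T n m) := by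
    intro n
    refine measurable_expNeg.comp (Measurable.const_mul ?_ c)
    refine Measurable.mul (Measurable.mul_const ?_ _) ?_
    · exact (measurable_of_finite fun e : Fin (B + 1) × Bool =>
        (if 1 ≤ (e.1 : ℕ) ∧ e.2 = true then (1 : ℝ≥0∞) else 0)).comp measurable_snd
    · exact (measurable_fst.pow_const 2).ennreal_ofReal
  have hlim : Tendsto (fun k => ∫⁻ ω, ∏ n ∈ Finset.range k, expNeg (c * T n (N.mark n ω)) ∂μ) atTop
      (𝓝 (∫⁻ ω, expNeg (c * interferenceOf α rx x (fun n => N.mark n ω)) ∂μ)) := by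
    refine tendsto_lintegral_of_dominated_convergence (fun _ => 1) (fun k => ?_)
      (fun k => Eventually.of_forall fun ω => Finset.prod_le_one' fun n _ => expNeg_le_one _)
      (by simp) (Eventually.of_forall fun ω => ?_)
    · exact Finset.measurable_fun_prod _ fun n _ => (hTm n).comp (h.measurable_mark n)
    · have := tendsto_expNeg_sum fun n => c * T n (N.mark n ω)
      rw [ENNReal.tsum_mul_left] at this
      convert this using 4
      unfold interferenceOf
      congr!
  have hprod : ∀ k, ∫⁻ ω, ∏ n ∈ Finset.range k, expNeg (c * T n (N.mark n ω)) ∂μ =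
      ∏ n ∈ Finset.range k, expNeg (-ENNReal.log
        (nodeLaplace σ α (ENNReal.ofReal (q * nonemptyProb ν)) c rx (x n))).toENNReal := by
    intro k
    rw [lintegral_prod_eq_prod_lintegral_of_indepFun (Finset.range k)
      (fun n ω => expNeg (c * T n (N.mark n ω)))
      (h.mark_indep.comp (fun n m => expNeg (c * T n m)) hTm)
      fun n => (hTm n).comp (h.measurable_mark n)]
    refine Finset.prod_congr rfl fun n _ => ?_
    rw [expNeg_toENNReal_neg_log (nodeLaplace_le_one ha rx (x n)), ← h.lintegral_mark hσ hq α c rx (x n) n]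
    refine lintegral_congr fun ω => ?_
    congr!
  simp_rw [hprod] at hlim
  exact tendsto_nhds_unique hlim (tendsto_expNeg_sum _)

/-- Tail of the signal-to-interference ratio, with the exponent in closed form. -/
theorem IsModel.measure_lt_sir (h : N.IsModel μ lam σ q ν) (hlam : 0 < lam) (hσ : 0 < σ)
    (hq : 0 ≤ q) (ha : ENNReal.ofReal (q * nonemptyProb ν) ≤ 1) {α θ : ℝ} (hα : 2 < α) (hθ : 0 < θ)
    {tx rx : Plane} (hd : 0 < dist rx tx) :
    μ {ω | ENNReal.ofReal θ < N.sir α tx rx ω} =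
      expNeg (ENNReal.ofReal (lam * (q * nonemptyProb ν) *
        ((θ * dist rx tx ^ α) ^ (2 / α) * kappa α))) := by
  have := h.isProb
  set d := dist rx tx with hdd
  set D := d ^ (-α) with hD
  have hD0 : 0 < D := Real.rpow_pos_of_pos hd _
  have hpl : ENNReal.ofReal d ^ (-α) = ENNReal.ofReal D := ENNReal.ofReal_rpow_of_pos hd
  set c := ENNReal.ofReal (θ / D / (2 * σ ^ 2)) with hc
  set a := ENNReal.ofReal (q * nonemptyProb ν) with haa
  set S : Set ((ℕ → Plane) × ℝ × (ℕ → ℝ × Fin (B + 1) × Bool)) := {z | ENNReal.ofReal θ <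
    ENNReal.ofReal D * ENNReal.ofReal (z.2.1 ^ 2) / interferenceOf α rx z.1 z.2.2} with hS
  have hSm : MeasurableSet S := by
    refine measurableSet_lt measurable_const (Measurable.div ?_ ?_)
    · fun_prop
    · exact (measurable_interferenceOf α rx).comp (by fun_prop :
        Measurable fun z : (ℕ → Plane) × ℝ × (ℕ → ℝ × Fin (B + 1) × Bool) => (z.1, z.2.2))
  have hX : Measurable fun ω n => N.loc n ω := measurable_pi_lambda _ h.loc_poisson.measurable
  have hM : Measurable fun ω n => N.mark n ω := measurable_pi_lambda _ h.measurable_mark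
  have hHM : Measurable fun ω => (N.ownGain ω, fun n => N.mark n ω) := h.ownGain_meas.prodMk hM
  have hlaw := (indepFun_iff_map_prod_eq_prod_map_map hX.aemeasurable hHM.aemeasurable).1 h.loc_indep
  rw [(indepFun_iff_map_prod_eq_prod_map_map h.ownGain_meas.aemeasurable hM.aemeasurable).1
    h.ownGain_indep, h.ownGain_law] at hlaw
  have hR : IsProbabilityMeasure (rayleighMeasure σ) :=
    h.ownGain_law ▸ Measure.isProbabilityMeasure_map h.ownGain_meas.aemeasurable
  have hPX := Measure.isProbabilityMeasure_map (μ := μ) hX.aemeasurable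
  have hPM := Measure.isProbabilityMeasure_map (μ := μ) hM.aemeasurable
  have hpre : {ω | ENNReal.ofReal θ < N.sir α tx rx ω} =
      (fun ω => ((fun n => N.loc n ω), N.ownGain ω, fun n => N.mark n ω)) ⁻¹' S := by
    ext ω
    change ENNReal.ofReal θ < N.sir α tx rx ω ↔ ENNReal.ofReal θ < _
    rw [sir, interference_eq, hpl]
  have hpsi : Measurable fun x : Plane =>
      (-ENNReal.log (nodeLaplace σ α a c rx x)).toENNReal :=
    measurable_ereal_toENNReal.comp ((measurable_nodeLaplace σ α a c rx).ennreal_log.neg)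
  -- For fixed locations, the own gain is integrated first, which produces the Laplace transform at
  -- `c`, and then the marks.
  have hin : ∀ x : ℕ → Plane, (rayleighMeasure σ).prod (μ.map fun ω n => N.mark n ω)
      (Prod.mk x ⁻¹' S) = expNeg (∑' n, (-ENNReal.log (nodeLaplace σ α a c rx (x n))).toENNReal) := by
    intro x
    rw [Measure.prod_apply_symm (measurable_prodMk_left hSm),
      ← h.lintegral_marks hσ hq ha α c rx x]
    have hmeas : Measurable fun m : ℕ → ℝ × Fin (B + 1) × Bool =>
        expNeg (c * interferenceOf α rx x m) :=
      measurable_expNeg.comp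
        (((measurable_interferenceOf α rx).comp measurable_prodMk_left).const_mul c)
    rw [← lintegral_map hmeas hM]
    refine lintegral_congr fun m => ?_
    rw [hc, ← rayleighMeasure_lt_div hσ hD0 hθ (interferenceOf α rx x m)]
    rfl
  rw [hpre, ← Measure.map_apply (hX.prodMk hHM) hSm, hlaw, Measure.prod_apply hSm]
  simp_rw [hin]
  have hsum : Measurable fun x : ℕ → Plane =>
      expNeg (∑' n, (-ENNReal.log (nodeLaplace σ α a c rx (x n))).toENNReal) :=
    measurable_expNeg.comp (Measurable.tsum fun n => hpsi.comp (measurable_pi_apply n))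
  rw [lintegral_map hsum hX, h.loc_poisson.laplace hlam.le hpsi]
  congr 1
  simp_rw [expNeg_toENNReal_neg_log (nodeLaplace_le_one ha rx _), one_sub_nodeLaplace ha]
  -- The common fading scale `σ` cancels here.
  have ht : ∀ y : ℝ≥0∞, ENNReal.ofReal (2 * σ ^ 2) * (c * y) = ENNReal.ofReal (θ * d ^ α) * y := by
    intro y
    rw [← mul_assoc, hc, ← ENNReal.ofReal_mul (by positivity)]
    congr 2
    rw [hD, Real.rpow_neg hd.le]
    field_simp
  simp_rw [ht]
  have hlp := lintegral_pathLoss hα (by positivity : 0 < θ * d ^ α) rx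
  rw [lintegral_const_mul' a _ ENNReal.ofReal_ne_top, hlp, ← mul_assoc,
    haa, ← ENNReal.ofReal_mul hlam.le, ← ENNReal.ofReal_mul' (by have := kappa_pos hα; positivity)]

end Network

theorem lamMax_pos {d θ α : ℝ} (hd : 0 < d) (hθ : 0 < θ) (hα : 2 < α) : 0 < lamMax d θ α := by
  have := kappa_pos hα
  unfold lamMax
  positivity

/-- Success probability of the typical pair. -/
theorem Network.IsModel.successProb_eq {B : ℕ} {Ω : Type*} {N : Network B Ω} [MeasurableSpace Ω]
    {μ : Measure Ω} {lam σ p q : ℝ} {ν : Fin (B + 1) → ℝ} (h : N.IsModel μ lam σ q ν)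
    (hν : IsStationary p q ν) (hlam : 0 < lam) (hσ : 0 < σ) (hq : q ∈ Icc (0 : ℝ) 1) {α θ : ℝ}
    (hα : 2 < α) (hθ : 0 < θ) {tx rx : Plane} (hd : 0 < dist rx tx) :
    N.successProb μ α θ tx rx =
      Real.exp (-(q * nonemptyProb ν / (lamMax (dist rx tx) θ α / lam))) := by
  have hr0 := hν.nonemptyProb_nonneg
  have hr1 := hν.nonemptyProb_le_one
  have hκ := kappa_pos hα
  rw [Network.successProb, measureReal_def, h.measure_lt_sir hlam hσ hq.1
    (ENNReal.ofReal_le_one.2 (mul_le_one₀ hq.2 hr0 hr1)) hα hθ hd, expNeg_ofReal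
    (mul_nonneg (mul_nonneg hlam.le (mul_nonneg hq.1 hr0)) (by positivity)),
    ENNReal.toReal_ofReal (Real.exp_pos _).le]
  congr 2
  have hd2 : (dist rx tx ^ α) ^ (2 / α) = dist rx tx ^ 2 := by
    rw [← Real.rpow_mul hd.le, mul_div_cancel₀ _ (by linarith : α ≠ 0), Real.rpow_two]
  rw [Real.mul_rpow hθ.le (by positivity), hd2, lamMax]
  field_simp

end HarvestAloha

/-! ### Maximizing `u * exp (-u)` and locating the least solution -/

namespace HarvestAloha

theorem mul_exp_neg_lt_exp_neg_one {u : ℝ} (hu : u ≠ 1) : u * Real.exp (-u) < Real.exp (-1) := by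
  have h := Real.add_one_lt_exp (sub_ne_zero.2 hu)
  have h2 := mul_lt_mul_of_pos_right h (Real.exp_pos (-u))
  rwa [← Real.exp_add, sub_add_cancel, show u - 1 + -u = -1 by ring] at h2

theorem mul_exp_neg_lt_mul_exp_neg {u v : ℝ} (hu : 0 ≤ u) (huv : u < v) (hv : v ≤ 1) :
    u * Real.exp (-u) < v * Real.exp (-v) := by
  have h := Real.add_one_lt_exp (sub_ne_zero.2 huv.ne)
  -- Indeed `v * (u - v + 1) = u + (v - u) * (1 - v) ≥ u`.
  have hlt : u < v * Real.exp (u - v) := by nlinarith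
  have h2 := mul_lt_mul_of_pos_right hlt (Real.exp_pos (-u))
  rwa [mul_assoc, ← Real.exp_add, show u - v + -u = -v by ring] at h2

/-- Whatever `f` does beyond `1`, a solution there exceeds `x ≤ 1`. -/
theorem solution_eq_of_unique {f : ℝ → ℝ} {c x : ℝ} (hx : x ∈ Icc (0 : ℝ) 1) (hfx : f x = c)
    (huniq : ∀ y ∈ Icc (0 : ℝ) 1, f y = c → y = x) : solution f c = x := by
  refine IsLeast.csInf_eq ⟨⟨x, ⟨hx.1, hfx⟩, rfl⟩, ?_⟩
  rintro _ ⟨y, ⟨hy0, hfy⟩, rfl⟩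
  refine EReal.coe_le_coe_iff.2 ?_
  rcases le_or_gt y 1 with hy1 | hy1
  · exact (huniq y ⟨hy0, hy1⟩ hfy).ge
  · exact hx.2.trans hy1.le

theorem one_le_solution {f : ℝ → ℝ} {c : ℝ} (h : ∀ y ∈ Icc (0 : ℝ) 1, f y ≠ c) :
    1 ≤ solution f c := by
  refine le_sInf ?_
  rintro _ ⟨y, ⟨hy0, hfy⟩, rfl⟩
  have hy : 1 < y := not_le.1 fun hy1 => h y ⟨hy0, hy1⟩ hfy
  exact EReal.coe_le_coe_iff.2 hy.le

end HarvestAloha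

open HarvestAloha
/-- `ν q` is a stationary law of the energy queue for access probability `q`, so that
`q * nonemptyProb (ν q)` is `f_B q` for `q ∈ [0, 1]`; the values of `ν` outside `[0, 1]` (hence the
extension of `f_B` beyond `[0, 1]`) are arbitrary. -/
theorem theorem2
    (lam p d α θ σ : ℝ) (B : ℕ)
    (hlam : 0 < lam) (hp0 : 0 < p) (hp1 : p ≤ 1) (hd : 0 < d) (hα : 2 < α) (hθ : 0 < θ)
    (hσ : 0 < σ) (hB : 1 ≤ B)
    (tx rx : Plane) (htx : dist rx tx = d)
    (ν : ℝ → Fin (B + 1) → ℝ) (hν : ∀ q ∈ Icc (0 : ℝ) 1, IsStationary p q (ν q))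
    (Ω : ℝ → Type*) [∀ q, MeasurableSpace (Ω q)] (μ : ∀ q, Measure (Ω q))
    (N : ∀ q, Network B (Ω q))
    (hN : ∀ q ∈ Icc (0 : ℝ) 1, (N q).IsModel (μ q) lam σ q (ν q))
    (f : ℝ → ℝ) (hf : ∀ q, f q = q * nonemptyProb (ν q))
    (C : ℝ → ℝ) (hC : ∀ q, C q = (N q).capacity (μ q) lam q (ν q) α θ tx rx) :
    (lamMax d θ α / lam ≤ p →
      ∃! x : ℝ, x ∈ Icc (0 : ℝ) 1 ∧ f x = lamMax d θ α / lam) ∧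
    (p < lamMax d θ α / lam → ∀ x ∈ Icc (0 : ℝ) 1, f x ≠ lamMax d θ α / lam) ∧
    ∃ qopt ∈ Icc (0 : ℝ) 1,
      (qopt : EReal) = min (solution f (lamMax d θ α / lam)) 1 ∧
      ∀ q ∈ Icc (0 : ℝ) 1, q ≠ qopt → C q < C qopt := by
  have hc : 0 < lamMax d θ α / lam := div_pos (lamMax_pos hd hθ hα) hlam
  generalize hcdef : lamMax d θ α / lam = c at *
  have hR : 0 < Real.logb 2 (1 + θ) := Real.logb_pos one_lt_two (by linarith)
  have hf' : f = fun q => q * nonemptyProb (ν q) := funext hf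
  have hmono : StrictMonoOn f (Icc 0 1) := hf' ▸ throughput_strictMonoOn hp0 hp1 hB hν
  have hf0 : ∀ q ∈ Icc (0 : ℝ) 1, 0 ≤ f q := fun q hq => by
    rw [hf]
    exact mul_nonneg hq.1 (hν q hq).nonemptyProb_nonneg
  have h1mem : (1 : ℝ) ∈ Icc (0 : ℝ) 1 := by simp
  have hf1 : f 1 = p := by rw [hf, one_mul, (hν 1 h1mem).nonemptyProb_of_access_one hp0 hp1 hB]
  -- The capacity depends on `q` only through `u = f q / c`.
  have hCq : ∀ q ∈ Icc (0 : ℝ) 1,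
      C q = lam * c * Real.logb 2 (1 + θ) * (f q / c * Real.exp (-(f q / c))) := by
    intro q hq
    rw [hC, Network.capacity, (hN q hq).successProb_eq (hν q hq) hlam hσ hq hα hθ (htx ▸ hd), htx,
      hcdef, ← hf, mul_assoc lam, ← hf]
    field_simp
  have hK : 0 < lam * c * Real.logb 2 (1 + θ) := by positivity
  have hno : p < c → ∀ x ∈ Icc (0 : ℝ) 1, f x ≠ c := fun hpc x hx hfx => by
    have := hmono.monotoneOn hx h1mem hx.2
    linarith
  have hex : c ≤ p → ∃ x ∈ Icc (0 : ℝ) 1, f x = c := fun hcp => by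
    rw [hf']
    exact exists_throughput_eq hp0 hp1 hB hν hc hcp
  refine ⟨fun hcp => ?_, hno, ?_⟩
  · obtain ⟨x, hx, hfx⟩ := hex hcp
    exact ⟨x, ⟨hx, hfx⟩, fun y hy => hmono.injOn hy.1 hx (hy.2.trans hfx.symm)⟩
  · rcases le_or_gt c p with hcp | hpc
    · obtain ⟨x, hx, hfx⟩ := hex hcp
      refine ⟨x, hx, ?_, fun q hq hqx => ?_⟩
      · rw [solution_eq_of_unique hx hfx fun y hy hfy => hmono.injOn hy hx (hfy.trans hfx.symm),
          min_eq_left (by exact_mod_cast hx.2)]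
      · rw [hCq q hq, hCq x hx, hfx, div_self hc.ne', one_mul]
        refine mul_lt_mul_of_pos_left (mul_exp_neg_lt_exp_neg_one fun h => hqx ?_) hK
        exact hmono.injOn hq hx (((div_eq_one_iff_eq hc.ne').1 h).trans hfx.symm)
    · refine ⟨1, h1mem, ?_, fun q hq hq1 => ?_⟩
      · rw [min_eq_right (one_le_solution (hno hpc)), EReal.coe_one]
      · rw [hCq q hq, hCq 1 h1mem]
        refine mul_lt_mul_of_pos_left (mul_exp_neg_lt_mul_exp_neg (div_nonneg (hf0 q hq) hc.le)
          (div_lt_div_of_pos_right (hmono hq h1mem (lt_of_le_of_ne hq.2 hq1)) hc) ?_) hK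
        -- The largest value of `u` is `p / c`, so `u` stays in the increasing range.
        rw [hf1]
        exact (div_le_one hc).2 hpc.le
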